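/- **Conventions.** Let $G$ be a (discrete) group acting by homeomorphisms on a topological space $X$. The action is *free* if no $g\neq e$ has a fixed point, and *topologically free* if for every $g\in G\setminus\{e\}$ the set $\{x\in X: gx=x\}$ has empty interior. It is *proximal* if for all $x,y\in X$ there is a net $(g_i)\subset G$ such that $(g_ix)$ and $(g_iy)$ converge and $\lim g_ix=\lim g_iy$. It is *strongly proximal* if the induced (push-forward) action on the space $\operatorname{Prob}(X)$ of regular Borel probability measures on $X$, with the weak topology given by integration against bounded continuous functions, is proximal. A *$G$-boundary* is a non-empty compact Hausdorff space with a minimal and strongly proximal action of $G$ by homeomorphisms. Given a subgroup $H\le G$, a $G$-boundary is *$H$-strongly proximal* if the restricted action of $H$ is strongly proximal. The *universal $H$-strongly proximal $G$-boundary* $B(G,H)$ is an $H$-strongly proximal $G$-boundary such that every $H$-strongly proximal $G$-boundary is the image of $B(G,H)$ under a continuous $G$-equivariant map. A topological space is *extremally disconnected* if the closure of every open set is open. **Proposition.** Let $\Gamma=\mathrm{PSL}(2,\mathbb Z)$ act on $\mathbb R\cup\{\infty\}$ by Möbius transformations, and let $\Gamma_\infty\le\Gamma$ be the stabilizer of $\infty$.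 Then a universal $\Gamma_\infty$-strongly proximal $\Gamma$-boundary $B(\Gamma,\Gamma_\infty)$ exists, and for every such $B(\Gamma,\Gamma_\infty)$ the action of $\Gamma$ on $B(\Gamma,\Gamma_\infty)$ is topologically free but not free. Moreover, $B(\Gamma,\Gamma_\infty)$ is not extremally disconnected. -/

import Mathlib

open Filter Topology MeasureTheory
open scoped MatrixGroups

universe u v

noncomputable section

/-! ### Dynamics of group actions -/

/-- An action is free if no non-trivial element of the group has a fixed point. -/
def IsFreeAction (G : Type*) (X : Type*) [Group G] [MulAction G X] : Prop :=
  ∀ g : G, g ≠ 1 → ∀ x : X, g • x ≠ x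

/-- An action is topologically free if the fixed point set of every non-trivial element of the
group has empty interior. -/
def IsTopologicallyFree (G : Type*) (X : Type*) [Group G] [TopologicalSpace X]
    [MulAction G X] : Prop :=
  ∀ g : G, g ≠ 1 → interior {x : X | g • x = x} = ∅

/-- An action is proximal if for all `x`, `y` there is a net `(gᵢ)` in the group such that
`gᵢ x` and `gᵢ y` converge to the same limit. Nets are expressed through proper filters. -/
def IsProximal (G : Type*) (X : Type*) [Group G] [TopologicalSpace X] [MulAction G X] : Prop :=
  ∀ x y : X, ∃ (F : Filter G) (z : X), F.NeBot ∧
    Tendsto (fun g : G => g • x) F (𝓝 z) ∧ Tendsto (fun g : G => g • y) F (𝓝 z)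

/-- The space of regular Borel probability measures on `X`. Its topology is the weak topology
(convergence of the integrals of bounded continuous functions), inherited from
`ProbabilityMeasure X`. -/
abbrev RegularProb (X : Type*) [TopologicalSpace X] [MeasurableSpace X] : Type _ :=
  {μ : ProbabilityMeasure X // (μ : Measure X).Regular}

/-- A group acting by homeomorphisms on `X` acts on regular probability measures by
push-forward. -/
instance RegularProb.instMulAction (G : Type*) (X : Type*) [Group G] [TopologicalSpace X]
    [MeasurableSpace X] [BorelSpace X] [MulAction G X] [ContinuousConstSMul G X] :
    MulAction G (RegularProb X) where
  smul g μ := ⟨μ.1.map (measurable_const_smul g).aemeasurable, by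
    have := μ.2
    exact Measure.Regular.map (μ := (μ.1 : Measure X)) (Homeomorph.smul g)⟩
  one_smul μ := by
    apply Subtype.ext
    apply Subtype.ext
    change Measure.map (fun x : X => (1 : G) • x) (μ.1 : Measure X) = _
    simp
  mul_smul g h μ := by
    apply Subtype.ext
    apply Subtype.ext
    change Measure.map (fun x : X => (g * h) • x) (μ.1 : Measure X) =
      Measure.map (fun x : X => g • x) (Measure.map (fun x : X => h • x) (μ.1 : Measure X))
    rw [Measure.map_map (measurable_const_smul g) (measurable_const_smul h)]
    congr 1
    ext x
    exact mul_smul g h x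

/-- An action by homeomorphisms is strongly proximal if the induced action on the space of
regular probability measures (for the Borel σ-algebra) is proximal. -/
def IsStronglyProximal (G : Type*) (X : Type*) [Group G] [TopologicalSpace X]
    [MulAction G X] [ContinuousConstSMul G X] : Prop :=
  letI : MeasurableSpace X := borel X
  have : BorelSpace X := ⟨rfl⟩
  IsProximal G (RegularProb X)

/-- A `G`-boundary: a non-empty compact Hausdorff space with a minimal and strongly proximal
action of `G` by homeomorphisms. -/
structure IsBoundary (G : Type*) (X : Type*) [Group G] [TopologicalSpace X]
    [MulAction G X] [ContinuousConstSMul G X] : Prop where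
  nonempty : Nonempty X
  compact : CompactSpace X
  hausdorff : T2Space X
  minimal : MulAction.IsMinimal G X
  stronglyProximal : IsStronglyProximal G X

/-- A subgroup of a group acting by homeomorphisms acts by homeomorphisms. -/
instance subgroupContinuousConstSMul (G : Type*) [Group G] (H : Subgroup G) (X : Type*)
    [TopologicalSpace X] [MulAction G X] [ContinuousConstSMul G X] : ContinuousConstSMul H X :=
  ⟨fun h => continuous_const_smul (h : G)⟩

/-- A `G`-boundary on which the subgroup `H` acts strongly proximally. -/
structure IsRelativeBoundary (G : Type*) [Group G] (H : Subgroup G) (X : Type*)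
    [TopologicalSpace X] [MulAction G X] [ContinuousConstSMul G X] : Prop where
  boundary : IsBoundary G X
  stronglyProximal : IsStronglyProximal H X

/-- `B` is the universal `H`-strongly proximal `G`-boundary `B(G, H)`: it is an `H`-strongly
proximal `G`-boundary, and every `H`-strongly proximal `G`-boundary is the image of `B` under a
continuous `G`-equivariant map. -/
structure IsUniversalRelativeBoundary (G : Type v) [Group G] (H : Subgroup G) (B : Type u)
    [TopologicalSpace B] [MulAction G B] [ContinuousConstSMul G B] : Prop where
  isRelativeBoundary : IsRelativeBoundary G H B
  universal : ∀ (X : Type u) [TopologicalSpace X] [MulAction G X] [ContinuousConstSMul G X],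
    IsRelativeBoundary G H X →
      ∃ φ : B → X, Continuous φ ∧ Function.Surjective φ ∧ ∀ (g : G) (b : B), φ (g • b) = g • φ b

/-! ### The modular group and its action on `ℝ ∪ {∞}` -/

/-- `SL(2, ℤ)` acts on `ℝ ∪ {∞}` by Möbius transformations, through `GL(2, ℝ)`. -/
def slMoebiusHom : SL(2, ℤ) →* Equiv.Perm (OnePoint ℝ) :=
  (MulAction.toPermHom (GL (Fin 2) ℝ) (OnePoint ℝ)).comp
    (Matrix.SpecialLinearGroup.toGL.comp
      (Matrix.SpecialLinearGroup.map (n := Fin 2) (Int.castRingHom ℝ)))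

theorem slMoebiusHom_center (A : SL(2, ℤ)) (hA : A ∈ Subgroup.center SL(2, ℤ)) :
    slMoebiusHom A = 1 := by
  obtain ⟨r, hr, hA⟩ := Matrix.SpecialLinearGroup.mem_center_iff.mp hA
  have hr0 : (r : ℝ) ≠ 0 := by
    rintro h
    have : r = 0 := by exact_mod_cast h
    simp [this] at hr
  have hA' : ∀ i j, A i j = if i = j then r else 0 := by
    intro i j
    rw [← hA, Matrix.scalar_apply, Matrix.diagonal_apply]
  have h00 : A 0 0 = r := hA' 0 0
  have h01 : A 0 1 = 0 := hA' 0 1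
  have h10 : A 1 0 = 0 := hA' 1 0
  have h11 : A 1 1 = r := hA' 1 1
  ext x : 1
  change Matrix.SpecialLinearGroup.toGL
    (Matrix.SpecialLinearGroup.map (n := Fin 2) (Int.castRingHom ℝ) A) • x = x
  cases x with
  | infty => simp [OnePoint.smul_infty_eq_ite, h10]
  | coe x => simp [OnePoint.smul_some_eq_ite, h00, h01, h10, h11, hr0]

/-- The action of `PSL(2, ℤ)` on `ℝ ∪ {∞}` by Möbius transformations. -/
instance pslMoebiusAction : MulAction PSL(2, ℤ) (OnePoint ℝ) :=
  MulAction.compHom (OnePoint ℝ)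
    (QuotientGroup.lift (Subgroup.center SL(2, ℤ)) slMoebiusHom slMoebiusHom_center)

/-- The stabilizer of `∞` in `PSL(2, ℤ)`. -/
def stabilizerInfty : Subgroup PSL(2, ℤ) :=
  MulAction.stabilizer PSL(2, ℤ) (OnePoint.infty : OnePoint ℝ)

end

/-!
Write `Γ = PSL(2, ℤ)` and let `t` be the translation `x ↦ x + 1`, which generates the stabilizer of
`∞`. Everything is based on a description of the boundaries relative to a cyclic subgroup `⟨t⟩`
that does not mention measures: a compact Hausdorff space is a `⟨t⟩`-strongly proximal
`G`-boundary if and only if it has a point `z` with dense orbit such that every neighbourhood of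
`z` is visited by the iterates `tⁿ x` with frequency tending to one, uniformly in `x`
(`IsAttractingBasepoint`). The point `z` is then fixed by `t`.

* If `z` is such a point, integrating averages of continuous functions along `t` shows that powers
  of `t` move any two probability measures simultaneously to the point mass at `z`
  (`IsAttractingBasepoint.isStronglyProximal`). Minimality is automatic, since all orbits
  accumulate at `z`.
* Conversely, proximality yields a fixed point `z` of `t`, and a failure of uniform concentration
  around `z` would yield, as a limit of empirical measures of orbit segments, a `t`-invariant
  probability measure other than the point mass at `z`. A proximal action does not admit two
  invariant measures (`IsRelativeBoundary.exists_attractingBasepoint`).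

The condition on `(X, z)` is one on the functions `g ↦ f (g z)` on `G`, for `f` continuous on `X`.
Taking all functions on `G` that satisfy it, the closure of the orbit of their joint evaluation at
the identity is again a space with an attracting base point, and it maps onto every other one
(`isUniversalRelativeBoundary_universalSpace`).

The real projective line with the base point `∞` satisfies the condition, and non-trivial elements
of `Γ` have finitely many fixed points on it. An open set of fixed points of `g ≠ 1` in the
universal boundary would, by minimality and compactness, have finitely many translates covering
the boundary, and so the infinite projective line would be covered by finitely many finite sets:
the action is topologically free. It is not free since `t` fixes `z`. Finally the fixed point set
of a homeomorphism of an extremally disconnected Hausdorff space is open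
(`ExtremallyDisconnected.isOpen_fixedPoints`), whereas that of `t` is non-empty with empty
interior.
-/

open Finset (range)

universe w

/-! ### Uniform averages along a cyclic group -/

section Averages

variable {G : Type*} [Group G] {X : Type*} [MulAction G X]

/-- The averages of `f` over the orbit segments `x, t x, …, tᴺ⁻¹ x` become at most `ε`, uniformly
in the starting point `x`. This is used for `f ≥ 0`, where it says that they tend to zero
uniformly. -/
def UniformlyAveragesToZero (t : G) (f : X → ℝ) : Prop :=
  ∀ ε > 0, ∀ᶠ N : ℕ in atTop, ∀ x : X, ∑ n ∈ range N, f (t ^ n • x) ≤ ε * N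

/-- The filter of sets whose complement is visited by the orbit segments `x, t x, …, tᴺ⁻¹ x` with
a frequency that tends to zero uniformly in the starting point `x`. -/
def uniformDensity (t : G) (X : Type*) [MulAction G X] : Filter X where
  sets := {U | UniformlyAveragesToZero t (Uᶜ.indicator (fun _ : X => (1 : ℝ)))}
  univ_sets := by
    rw [Set.mem_ofPred_eq]
    exact fun ε hε => .of_forall fun N x => by simp; positivity
  sets_of_superset {U V} hU hUV := by
    rw [Set.mem_ofPred_eq] at hU ⊢
    exact fun ε hε => (hU ε hε).mono fun N hN x => LE.le.trans
      (Finset.sum_le_sum fun n _ => Set.indicator_le_indicator_of_subset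
        (Set.compl_subset_compl.mpr hUV) (fun _ => zero_le_one) (t ^ n • x)) (hN x)
  inter_sets {U V} hU hV := by
    rw [Set.mem_ofPred_eq] at hU hV ⊢
    intro ε hε
    filter_upwards [hU (ε / 2) (by positivity), hV (ε / 2) (by positivity)] with N h₁ h₂ x
    have : ∀ y : X, (U ∩ V)ᶜ.indicator (fun _ : X => (1 : ℝ)) y ≤
        Uᶜ.indicator (fun _ : X => (1 : ℝ)) y + Vᶜ.indicator (fun _ : X => (1 : ℝ)) y := by
      intro y
      by_cases hy : y ∈ U <;> by_cases hz : y ∈ V <;> simp [hy, hz]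
    calc _ ≤ _ := Finset.sum_le_sum fun n _ => this (t ^ n • x)
      _ ≤ ε / 2 * N + ε / 2 * N := by
        rw [Finset.sum_add_distrib]; exact add_le_add (h₁ x) (h₂ x)
      _ = ε * N := by ring

theorem mem_uniformDensity {t : G} {U : Set X} : U ∈ uniformDensity t X ↔
    UniformlyAveragesToZero t (Uᶜ.indicator (fun _ : X => (1 : ℝ))) := by
  rw [uniformDensity, Filter.mem_mk, Set.mem_ofPred_eq]

/-- Markov's inequality. -/
theorem UniformlyAveragesToZero.mem_uniformDensity {t : G} {f : X → ℝ}
    (hf : UniformlyAveragesToZero t f) (h0 : ∀ x, 0 ≤ f x) {c : ℝ} (hc : 0 < c) {U : Set X}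
    (hU : ∀ x ∉ U, c ≤ f x) : U ∈ uniformDensity t X := by
  rw [_root_.mem_uniformDensity]
  intro ε hε
  filter_upwards [hf (c * ε) (by positivity)] with N hN x
  have : ∀ y : X, c * Uᶜ.indicator (fun _ : X => (1 : ℝ)) y ≤ f y := by
    intro y
    by_cases hy : y ∈ U
    · simpa [hy] using h0 y
    · simpa [hy] using hU y hy
  have h := (Finset.sum_le_sum fun n (_ : n ∈ range N) => this (t ^ n • x)).trans (hN x)
  rw [← Finset.mul_sum, mul_assoc] at h
  exact le_of_mul_le_mul_left h hc

theorem UniformlyAveragesToZero.tendsto {t : G} {f : X → ℝ}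
    (hf : UniformlyAveragesToZero t f) (h0 : ∀ x, 0 ≤ f x) :
    Tendsto f (uniformDensity t X) (𝓝 0) := by
  rw [Metric.tendsto_nhds]
  intro ε hε
  refine hf.mem_uniformDensity h0 hε fun x hx => ?_
  simpa [abs_of_nonneg (h0 x)] using hx

theorem uniformlyAveragesToZero_of_tendsto {t : G} {f : X → ℝ} {M : ℝ} (hM : ∀ x, f x ≤ M)
    (hf : Tendsto f (uniformDensity t X) (𝓝 0)) : UniformlyAveragesToZero t f := by
  intro ε hε
  have hU : {x | f x < ε / 2} ∈ uniformDensity t X := hf.eventually_lt_const (by positivity)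
  have hM' : 0 < |M| + 1 := by positivity
  filter_upwards [mem_uniformDensity.mp hU (ε / 2 / (|M| + 1)) (by positivity)] with N hN x
  have : ∀ y : X, f y ≤ ε / 2 +
      (|M| + 1) * {x | f x < ε / 2}ᶜ.indicator (fun _ : X => (1 : ℝ)) y := by
    intro y
    by_cases hy : f y < ε / 2
    · simpa [hy] using hy.le
    · have := (hM y).trans (le_abs_self M)
      simp [hy]
      linarith
  calc _ ≤ _ := Finset.sum_le_sum fun n _ => this (t ^ n • x)
    _ ≤ N * (ε / 2) + (|M| + 1) * (ε / 2 / (|M| + 1) * N) := by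
      rw [Finset.sum_add_distrib, ← Finset.mul_sum]
      gcongr
      · simp
      · exact hN x
    _ = ε * N := by field_simp; ring

theorem exists_pow_smul_mem_of_mem_uniformDensity {t : G} {U : Set X}
    (hU : U ∈ uniformDensity t X) (x : X) : ∃ n : ℕ, t ^ n • x ∈ U := by
  by_contra! h
  obtain ⟨N, hN, hN0⟩ := ((mem_uniformDensity.mp hU (1 / 2) (by norm_num)).and
    (eventually_gt_atTop 0)).exists
  have := hN x
  have hN0 : (0 : ℝ) < N := by exact_mod_cast hN0
  simp [h] at this
  linarith

end Averages

/-- A point `z` with dense orbit under `G` around which all orbits of `t` concentrate: each of its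
neighbourhoods is visited by the iterates of `t` with a frequency that tends to one, uniformly in
the starting point. -/
structure IsAttractingBasepoint {G : Type*} [Group G] (t : G) {X : Type*} [TopologicalSpace X]
    [MulAction G X] (z : X) : Prop where
  denseRange : DenseRange fun g : G => g • z
  uniformDensity_le : uniformDensity t X ≤ 𝓝 z

section Criterion

variable {G : Type*} [Group G] {X : Type*} [TopologicalSpace X] [MulAction G X]
  [ContinuousConstSMul G X]

omit [ContinuousConstSMul G X] in
theorem IsAttractingBasepoint.uniformlyAveragesToZero [CompactSpace X] {t : G} {z : X}
    (hz : IsAttractingBasepoint t z) {f : X → ℝ} (hf : Continuous f) (h0 : f z = 0) :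
    UniformlyAveragesToZero t f := by
  obtain ⟨M, hM⟩ := (isCompact_range hf).bddAbove
  refine uniformlyAveragesToZero_of_tendsto (M := M) (fun x => hM ⟨x, rfl⟩) ?_
  have := hf.tendsto z
  rw [h0] at this
  exact this.mono_left hz.uniformDensity_le

theorem IsAttractingBasepoint.isMinimal {t : G} {z : X}
    (hz : IsAttractingBasepoint t z) : MulAction.IsMinimal G X := by
  refine ⟨fun x => dense_iff_inter_open.mpr fun U hU hne => ?_⟩
  obtain ⟨g, hg⟩ := hz.denseRange.exists_mem_open hU hne
  obtain ⟨n, hn⟩ := exists_pow_smul_mem_of_mem_uniformDensity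
    (hz.uniformDensity_le ((hU.preimage (continuous_const_smul g)).mem_nhds hg)) x
  exact ⟨g • t ^ n • x, hn, g * t ^ n, mul_smul _ _ _⟩

theorem IsStronglyProximal.of_subgroup {H : Subgroup G} (h : IsStronglyProximal H X) :
    IsStronglyProximal G X := by
  intro μ ν
  obtain ⟨F, z, hF, h₁, h₂⟩ := h μ ν
  exact ⟨F.map Subtype.val, z, hF.map _, tendsto_map'_iff.mpr h₁, tendsto_map'_iff.mpr h₂⟩

end Criterion

section Measures

variable {X : Type*} [TopologicalSpace X] [MeasurableSpace X] [BorelSpace X]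

theorem regular_dirac [T1Space X] (x : X) : (Measure.dirac x).Regular where
  lt_top_of_isCompact K _ := measure_lt_top _ K
  outerRegular A hA r hr := by
    by_cases hx : x ∈ A
    · refine ⟨Set.univ, Set.subset_univ _, isOpen_univ, ?_⟩
      simpa [hx, hA] using hr
    · refine ⟨{x}ᶜ, by simpa using hx, isOpen_compl_singleton, ?_⟩
      rw [Measure.dirac_apply' _ hA] at hr
      rw [Measure.dirac_apply' _ (isOpen_compl_singleton.measurableSet)]
      simpa [hx] using hr
  innerRegular U hU r hr := by
    by_cases hx : x ∈ U
    · refine ⟨{x}, by simpa using hx, isCompact_singleton, ?_⟩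
      rw [Measure.dirac_apply' _ hU.measurableSet] at hr
      rw [Measure.dirac_apply' _ isClosed_singleton.measurableSet]
      simpa [hx] using hr
    · rw [Measure.dirac_apply' _ hU.measurableSet] at hr
      simp [hx] at hr

/-- The point mass at `x`. -/
noncomputable def RegularProb.dirac [T1Space X] (x : X) : RegularProb X :=
  ⟨diracProba x, regular_dirac x⟩

theorem RegularProb.integral_dirac [T1Space X] (x : X) {f : X → ℝ} (hf : Continuous f) :
    ∫ y, f y ∂((RegularProb.dirac x).1 : Measure X) = f x :=
  integral_dirac' f x hf.measurable.stronglyMeasurable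

theorem RegularProb.tendsto_iff [CompactSpace X] {α : Type*} {F : Filter α}
    {μs : α → RegularProb X} {μ : RegularProb X} :
    Tendsto μs F (𝓝 μ) ↔ ∀ f : C(X, ℝ),
      Tendsto (fun a => ∫ x, f x ∂((μs a).1 : Measure X)) F (𝓝 (∫ x, f x ∂(μ.1 : Measure X))) := by
  rw [tendsto_subtype_rng, ProbabilityMeasure.tendsto_iff_forall_integral_tendsto]
  exact ⟨fun h f => h (BoundedContinuousFunction.mkOfCompact f), fun h f => h f.toContinuousMap⟩

theorem RegularProb.integrable [CompactSpace X] (μ : RegularProb X) {f : X → ℝ}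
    (hf : Continuous f) : Integrable f (μ.1 : Measure X) :=
  (BoundedContinuousFunction.mkOfCompact ⟨f, hf⟩).integrable _

theorem RegularProb.integral_smul {G : Type*} [Group G] [MulAction G X] [ContinuousConstSMul G X]
    (g : G) (μ : RegularProb X) {f : X → ℝ} (hf : Continuous f) :
    ∫ x, f x ∂((g • μ).1 : Measure X) = ∫ x, f (g • x) ∂(μ.1 : Measure X) :=
  integral_map (measurable_const_smul g).aemeasurable hf.measurable.aestronglyMeasurable

end Measures

/-! ### Strong proximality of a cyclic group -/

section StrongProximality

variable {G : Type*} [Group G] {X : Type*} [TopologicalSpace X] [MulAction G X]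
  [ContinuousConstSMul G X] [CompactSpace X] [T2Space X]

omit [T2Space X] in
/-- Averaging `f` over orbit segments under the integral sign produces an element moving the mass
of two measures simultaneously towards `z`. -/
theorem IsAttractingBasepoint.exists_integral_lt [MeasurableSpace X] [BorelSpace X] {t : G} {z : X}
    (hz : IsAttractingBasepoint t z) {f : X → ℝ} (hf : Continuous f) (h0 : f z = 0)
    (μ ν : RegularProb X) {ε : ℝ} (hε : 0 < ε) :
    ∃ n : ℕ, ∫ x, f (t ^ n • x) ∂(μ.1 : Measure X) + ∫ x, f (t ^ n • x) ∂(ν.1 : Measure X) < ε := by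
  obtain ⟨N, hN, hN0⟩ := ((hz.uniformlyAveragesToZero hf h0 (ε / 3) (by positivity)).and
    (eventually_gt_atTop 0)).exists
  have hc : ∀ n : ℕ, Continuous fun x => f (t ^ n • x) :=
    fun n => hf.comp (continuous_const_smul _)
  have key : ∀ ρ : RegularProb X,
      ∑ n ∈ range N, ∫ x, f (t ^ n • x) ∂(ρ.1 : Measure X) ≤ ε / 3 * N := by
    intro ρ
    rw [← integral_finsetSum _ fun n _ => ρ.integrable (hc n)]
    calc _ ≤ ∫ _, ε / 3 * N ∂(ρ.1 : Measure X) :=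
          integral_mono (integrable_finsetSum _ fun n _ => ρ.integrable (hc n))
            (integrable_const _) hN
      _ = ε / 3 * N := by simp
  by_contra! h
  have h₁ := Finset.card_nsmul_le_sum (range N) _ ε fun n _ => h n
  rw [Finset.sum_add_distrib, Finset.card_range, nsmul_eq_mul] at h₁
  have := key μ
  have := key ν
  have : (0 : ℝ) < ε * N := by positivity
  linarith

theorem IsAttractingBasepoint.isStronglyProximal {t : G} {z : X}
    (hz : IsAttractingBasepoint t z) : IsStronglyProximal (Subgroup.zpowers t) X := by
  let _ : MeasurableSpace X := borel X
  have : BorelSpace X := ⟨rfl⟩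
  change IsProximal (Subgroup.zpowers t) (RegularProb X)
  intro μ ν
  -- The total mass, measured by `f`, which `h` fails to move from `μ` and `ν` to `z`.
  let I : C(X, ℝ) → Subgroup.zpowers t → ℝ := fun f h =>
    ∫ x, f (h • x) ∂(μ.1 : Measure X) + ∫ x, f (h • x) ∂(ν.1 : Measure X)
  have hint : ∀ (ρ : RegularProb X) (f : C(X, ℝ)) (h : Subgroup.zpowers t),
      Integrable (fun x => f (h • x)) (ρ.1 : Measure X) :=
    fun ρ f h => ρ.integrable (f.continuous.comp (continuous_const_smul h))
  let S := {f : C(X, ℝ) // 0 ≤ f ∧ f z = 0}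
  -- A sequence of group elements need not suffice, as `X` may be non-metrizable.
  let F : Filter (Subgroup.zpowers t) := ⨅ f : S, comap (I f.1) (𝓝 0)
  have hI : ∀ f : S, Tendsto (I f.1) F (𝓝 0) := fun f =>
    tendsto_comap.mono_left (iInf_le _ f)
  have hnonneg : ∀ (ρ : RegularProb X) (f : S) (h : Subgroup.zpowers t),
      0 ≤ ∫ x, f.1 (h • x) ∂(ρ.1 : Measure X) := fun ρ f h => integral_nonneg fun x => f.2.1 _
  have hmono : ∀ f g : S, f.1 ≤ g.1 → comap (I g.1) (𝓝 0) ≤ comap (I f.1) (𝓝 0) := by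
    intro f g hfg
    rw [← tendsto_iff_comap]
    refine tendsto_of_tendsto_of_tendsto_of_le_of_le tendsto_const_nhds tendsto_comap
      (fun h => add_nonneg (hnonneg μ f h) (hnonneg ν f h)) fun h => ?_
    exact add_le_add (integral_mono (hint μ _ h) (hint μ _ h) fun x => hfg _)
      (integral_mono (hint ν _ h) (hint ν _ h) fun x => hfg _)
  have hF : F.NeBot := by
    have : Nonempty S := ⟨⟨0, le_rfl, rfl⟩⟩
    refine iInf_neBot_of_directed' ?_ fun f => ?_
    · intro f g
      refine ⟨⟨f.1 + g.1, add_nonneg f.2.1 g.2.1, by simp [f.2.2, g.2.2]⟩, ?_, ?_⟩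
      · exact hmono _ _ (le_add_of_nonneg_right g.2.1)
      · exact hmono _ _ (le_add_of_nonneg_left f.2.1)
    · rw [comap_neBot_iff]
      intro s hs
      obtain ⟨ε, hε, hs⟩ := Metric.mem_nhds_iff.mp hs
      obtain ⟨n, hn⟩ := hz.exists_integral_lt f.1.continuous f.2.2 μ ν hε
      refine ⟨⟨t ^ n, n, by simp⟩, hs ?_⟩
      rw [Metric.mem_ball, Real.dist_eq, sub_zero, abs_of_nonneg]
      · exact hn
      · exact add_nonneg (hnonneg μ f _) (hnonneg ν f _)
  have hlim : ∀ ρ : RegularProb X,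
      (∀ (f : S) (h : Subgroup.zpowers t), ∫ x, f.1 (h • x) ∂(ρ.1 : Measure X) ≤ I f.1 h) →
      Tendsto (fun h : Subgroup.zpowers t => h • ρ) F (𝓝 (RegularProb.dirac z)) := by
    intro ρ hρ
    rw [RegularProb.tendsto_iff]
    intro f
    rw [RegularProb.integral_dirac _ f.continuous, tendsto_iff_norm_sub_tendsto_zero]
    let g : S := ⟨|f - ContinuousMap.const X (f z)|, abs_nonneg _, by simp⟩
    refine squeeze_zero (fun _ => norm_nonneg _) (fun h => ?_) (hI g)
    refine le_trans ?_ (hρ g h)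
    rw [RegularProb.integral_smul h ρ f.continuous]
    calc _ = ‖∫ x, (f (h • x) - f z) ∂(ρ.1 : Measure X)‖ := by
          rw [integral_sub (hint ρ f h) (integrable_const _)]; simp
      _ ≤ ∫ x, ‖f (h • x) - f z‖ ∂(ρ.1 : Measure X) := norm_integral_le_integral_norm _
      _ = _ := by simp [g]
  exact ⟨F, RegularProb.dirac z, hF,
    hlim μ fun f h => le_add_of_nonneg_right (hnonneg ν f h),
    hlim ν fun f h => le_add_of_nonneg_left (hnonneg μ f h)⟩

/-- Proximality moves `x` and `t x` to a common limit, which is fixed by `t` because `t` commutes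
with its powers. -/
theorem IsStronglyProximal.exists_fixed_point [Nonempty X] {t : G}
    (h : IsStronglyProximal (Subgroup.zpowers t) X) : ∃ z : X, t • z = z := by
  let _ : MeasurableSpace X := borel X
  have : BorelSpace X := ⟨rfl⟩
  change IsProximal (Subgroup.zpowers t) (RegularProb X) at h
  inhabit X
  let x : X := default
  obtain ⟨F, ν, hF, h₁, h₂⟩ := h (RegularProb.dirac x) (RegularProb.dirac (t • x))
  rw [RegularProb.tendsto_iff] at h₁ h₂
  have hsmul : ∀ (f : C(X, ℝ)) (y : X) (a : Subgroup.zpowers t),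
      ∫ w, f w ∂((a • RegularProb.dirac y).1 : Measure X) = f (a • y) := by
    intro f y a
    rw [RegularProb.integral_smul _ _ f.continuous,
      RegularProb.integral_dirac y (f := fun w => f (a • w))
        (f.continuous.comp (continuous_const_smul a))]
  simp only [hsmul] at h₁ h₂
  let U := Ultrafilter.of F
  obtain ⟨y, -, hy⟩ := isCompact_univ.ultrafilter_le_nhds
    (U.map fun a : Subgroup.zpowers t => a • x) (by simp)
  have hy : Tendsto (fun a : Subgroup.zpowers t => a • x) U (𝓝 y) := hy
  refine ⟨y, ?_⟩
  by_contra hne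
  obtain ⟨f, hf₀, hf₁, -⟩ := exists_continuous_zero_one_of_isClosed
    (isClosed_singleton (x := t • y)) (isClosed_singleton (x := y)) (by simpa using hne)
  have e₁ : f y = ∫ w, f w ∂(ν.1 : Measure X) :=
    tendsto_nhds_unique ((f.continuous.tendsto y).comp hy) ((h₁ f).mono_left (Ultrafilter.of_le F))
  have e₂ : f (t • y) = ∫ w, f w ∂(ν.1 : Measure X) := by
    refine tendsto_nhds_unique (((f.continuous.comp (continuous_const_smul t)).tendsto y).comp hy)
      (((h₂ f).mono_left (Ultrafilter.of_le F)).congr fun a => ?_)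
    obtain ⟨_, n, rfl⟩ := a
    simp only [Function.comp, Subgroup.smul_def, smul_smul]
    rw [(Commute.refl t).zpow_left n]
  have := e₁.trans e₂.symm
  rw [hf₀ (Set.mem_singleton _), hf₁ (Set.mem_singleton _)] at this
  simp at this

/-- The uniform probability measure on the orbit segment `x, t x, …, tᴺ x`. -/
noncomputable def empiricalMeasure [MeasurableSpace X] (t : G) (N : ℕ) (x : X) :
    ProbabilityMeasure X :=
  ⟨((N + 1 : ℕ) : ENNReal)⁻¹ • ∑ n ∈ range (N + 1), Measure.dirac (t ^ n • x), ⟨by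
    rw [Measure.smul_apply, Measure.finsetSum_apply]
    simp only [measure_univ, Finset.sum_const, Finset.card_range, smul_eq_mul, nsmul_eq_mul,
      mul_one]
    exact ENNReal.inv_mul_cancel (by simp) (by simp)⟩⟩

omit [ContinuousConstSMul G X] [CompactSpace X] [T2Space X] in
theorem integral_empiricalMeasure [MeasurableSpace X] [BorelSpace X] (t : G) (N : ℕ) (x : X)
    {f : X → ℝ} (hf : Continuous f) :
    ∫ y, f y ∂(empiricalMeasure t N x : Measure X) =
      ((N : ℝ) + 1)⁻¹ * ∑ n ∈ range (N + 1), f (t ^ n • x) := by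
  rw [empiricalMeasure, ProbabilityMeasure.coe_mk, integral_smul_measure,
    integral_finsetSum_measure]
  · simp only [integral_dirac' f _ hf.measurable.stronglyMeasurable, ENNReal.toReal_inv,
      ENNReal.toReal_natCast, smul_eq_mul]
    rw [Nat.cast_succ]
  · intro n _
    exact integrable_dirac' hf.measurable.stronglyMeasurable (by simp)

omit [T2Space X] in
/-- Limits of empirical measures of longer and longer orbit segments are invariant. -/
theorem integral_smul_eq_of_tendsto_empiricalMeasure [MeasurableSpace X] [BorelSpace X] {t : G}
    {U : Filter ℕ} [U.NeBot] (hU : U ≤ atTop) {x : ℕ → X} {I : C(X, ℝ) → ℝ}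
    (hI : ∀ f : C(X, ℝ), Tendsto
      (fun N => ∫ y, f y ∂(empiricalMeasure t N (x N) : Measure X)) U (𝓝 (I f))) (f : C(X, ℝ)) :
    I (f.comp ⟨fun y => t • y, continuous_const_smul t⟩) = I f := by
  rw [← sub_eq_zero]
  obtain ⟨M, hM⟩ := (isCompact_range f.continuous.norm).bddAbove
  have hM : ∀ y, ‖f y‖ ≤ M := fun y => hM ⟨y, rfl⟩
  refine tendsto_nhds_unique ((hI _).sub (hI f)) ?_
  have h0 : Tendsto (fun N : ℕ => 2 * M * ((N : ℝ) + 1)⁻¹) U (𝓝 0) := by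
    have := (tendsto_one_div_add_atTop_nhds_zero_nat (𝕜 := ℝ)).const_mul (2 * M)
    simpa using this.mono_left hU
  refine squeeze_zero_norm (fun N => ?_) h0
  rw [integral_empiricalMeasure _ _ _ (ContinuousMap.continuous _),
    integral_empiricalMeasure _ _ _ f.continuous, ← mul_sub, ← Finset.sum_sub_distrib]
  have : ∀ n, f.comp ⟨fun y => t • y, continuous_const_smul t⟩ (t ^ n • x N) =
      f (t ^ (n + 1) • x N) := fun n => by
    simp [smul_smul, pow_succ']
  simp only [this]
  rw [Finset.sum_range_sub (fun n => f (t ^ n • x N)), norm_mul, mul_comm,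
    Real.norm_of_nonneg (r := ((N : ℝ) + 1)⁻¹) (by positivity)]
  refine mul_le_mul_of_nonneg_right ((norm_sub_le _ _).trans ?_) (by positivity)
  linarith [hM (t ^ (N + 1) • x N), hM (t ^ 0 • x N)]

/-- Strong proximality forces the point mass at the fixed point `z` to be the only invariant
measure, so no orbit segments can equidistribute towards anything else. -/
theorem IsStronglyProximal.uniformlyAveragesToZero {t : G}
    (h : IsStronglyProximal (Subgroup.zpowers t) X) {z : X} (hz : t • z = z) (f : C(X, ℝ))
    (hf : ∀ x, 0 ≤ f x) (h0 : f z = 0) : UniformlyAveragesToZero t f := by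
  let _ : MeasurableSpace X := borel X
  have : BorelSpace X := ⟨rfl⟩
  change IsProximal (Subgroup.zpowers t) (RegularProb X) at h
  intro ε hε
  by_contra hcon
  rw [not_eventually] at hcon
  push Not at hcon
  have : Nonempty X := ⟨z⟩
  have hx : ∀ N : ℕ, ∃ x : X, (∃ x, ε * N < ∑ n ∈ range N, f (t ^ n • x)) →
      ε * N < ∑ n ∈ range N, f (t ^ n • x) := by
    intro N
    by_cases hN : ∃ x, ε * N < ∑ n ∈ range N, f (t ^ n • x)
    · exact ⟨hN.choose, fun _ => hN.choose_spec⟩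
    · exact ⟨z, fun h => absurd h hN⟩
  choose x hx using hx
  have hfreq : ∃ᶠ N : ℕ in atTop, ε * N < ∑ n ∈ range N, f (t ^ n • x N) := hcon.mono hx
  have := frequently_iff_neBot.mp hfreq
  let U := Ultrafilter.of (atTop ⊓ 𝓟 {N : ℕ | ε * N < ∑ n ∈ range N, f (t ^ n • x N)})
  have hU : (U : Filter ℕ) ≤ atTop := (Ultrafilter.of_le _).trans inf_le_left
  have hU' : ∀ᶠ N in (U : Filter ℕ), ε * N < ∑ n ∈ range N, f (t ^ n • x N) :=
    le_principal_iff.mp ((Ultrafilter.of_le _).trans inf_le_right)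
  obtain ⟨μ, -, hμ⟩ := isCompact_univ.ultrafilter_le_nhds
    (U.map fun N => empiricalMeasure t N (x N)) (by simp)
  have hμ : Tendsto (fun N => empiricalMeasure t N (x N)) U (𝓝 μ) := hμ
  rw [ProbabilityMeasure.tendsto_iff_forall_integral_tendsto] at hμ
  obtain ⟨ν, hνreg, hνfin, hν⟩ := (μ : Measure X).exists_regular_eq_of_compactSpace
  have hlim : ∀ g : C(X, ℝ), Tendsto
      (fun N => ∫ y, g y ∂(empiricalMeasure t N (x N) : Measure X)) U (𝓝 (∫ y, g y ∂ν)) := by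
    intro g
    have := hμ (BoundedContinuousFunction.mkOfCompact g)
    rw [hν] at this
    exact this
  have hprob : IsProbabilityMeasure ν := by
    have := hν (BoundedContinuousFunction.const X 1)
    simp only [BoundedContinuousFunction.const_apply, integral_const, probReal_univ, smul_eq_mul,
      mul_one] at this
    exact ⟨by rw [← ENNReal.toReal_eq_one_iff]; exact this.symm⟩
  let ρ : RegularProb X := ⟨⟨ν, hprob⟩, hνreg⟩
  have hinv : ∀ a : Subgroup.zpowers t, ∀ g : C(X, ℝ), ∫ y, g (a • y) ∂ν = ∫ y, g y ∂ν := by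
    let K : Subgroup G :=
      { carrier := {a | ∀ g : C(X, ℝ), ∫ y, g (a • y) ∂ν = ∫ y, g y ∂ν}
        one_mem' := fun g => by simp
        mul_mem' := fun {a b} ha hb g => by
          have := hb (g.comp ⟨fun y => a • y, continuous_const_smul a⟩)
          simp only [ContinuousMap.comp_apply, ContinuousMap.coe_mk, smul_smul] at this
          rw [this, ha g]
        inv_mem' := fun {a} ha g => by
          have := ha (g.comp ⟨fun y => a⁻¹ • y, continuous_const_smul a⁻¹⟩)
          simp only [ContinuousMap.comp_apply, ContinuousMap.coe_mk, inv_smul_smul] at this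
          exact this.symm }
    have htK : t ∈ K := integral_smul_eq_of_tendsto_empiricalMeasure hU hlim
    exact fun a => Subgroup.zpowers_le.mpr htK a.2
  have hfix : ∀ a : Subgroup.zpowers t, a • z = z := fun a =>
    (Subgroup.zpowers_le (H := MulAction.stabilizer G z)).mpr hz a.2
  obtain ⟨F, σ, hF, h₁, h₂⟩ := h ρ (RegularProb.dirac z)
  rw [RegularProb.tendsto_iff] at h₁ h₂
  replace h₁ := h₁ f
  replace h₂ := h₂ f
  simp only [RegularProb.integral_smul _ _ f.continuous] at h₁ h₂
  have e₁ : ∀ a : Subgroup.zpowers t, ∫ y, f (a • y) ∂(ρ.1 : Measure X) = ∫ y, f y ∂ν :=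
    fun a => hinv a f
  have e₂ : ∀ a : Subgroup.zpowers t,
      ∫ y, f (a • y) ∂((RegularProb.dirac z).1 : Measure X) = 0 := fun a => by
    rw [RegularProb.integral_dirac z (f := fun w => f (a • w))
      (f.continuous.comp (continuous_const_smul a)), hfix, h0]
  simp only [e₁] at h₁
  simp only [e₂] at h₂
  have hzero : ∫ y, f y ∂ν = 0 :=
    (tendsto_nhds_unique tendsto_const_nhds h₁).trans (tendsto_nhds_unique h₂ tendsto_const_nhds)
  -- The empirical measures have `N + 1` atoms, and `N / (N + 1) ≥ 1 / 2`.
  have hge : ε / 2 ≤ ∫ y, f y ∂ν := by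
    refine ge_of_tendsto (hlim f) ?_
    filter_upwards [hU', hU (eventually_ge_atTop 1)] with N hN hN1
    rw [integral_empiricalMeasure _ _ _ f.continuous, Finset.sum_range_succ]
    have hN1 : (1 : ℝ) ≤ N := by exact_mod_cast hN1
    have := hf (t ^ N • x N)
    rw [inv_mul_eq_div, le_div_iff₀ (by positivity)]
    nlinarith
  linarith

theorem IsRelativeBoundary.exists_attractingBasepoint {t : G}
    (h : IsRelativeBoundary G (Subgroup.zpowers t) X) :
    ∃ z : X, t • z = z ∧ IsAttractingBasepoint t z := by
  have := h.boundary.nonempty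
  have := h.boundary.minimal
  obtain ⟨z, hz⟩ := h.stronglyProximal.exists_fixed_point
  refine ⟨z, hz, MulAction.dense_orbit G z, fun V hV => ?_⟩
  obtain ⟨W, hWV, hW, hzW⟩ := mem_nhds_iff.mp hV
  obtain ⟨f, hf₀, hf₁, hf⟩ := exists_continuous_zero_one_of_isClosed
    (isClosed_singleton (x := z)) hW.isClosed_compl (by simpa using hzW)
  refine mem_of_superset ?_ hWV
  exact (h.stronglyProximal.uniformlyAveragesToZero hz f (fun x => (hf x).1)
    (hf₀ rfl)).mem_uniformDensity (fun x => (hf x).1) one_pos fun x hx => (hf₁ hx).ge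

theorem IsAttractingBasepoint.isRelativeBoundary {t : G} {z : X}
    (hz : IsAttractingBasepoint t z) : IsRelativeBoundary G (Subgroup.zpowers t) X where
  boundary :=
    { nonempty := ⟨z⟩
      compact := inferInstance
      hausdorff := inferInstance
      minimal := hz.isMinimal
      stronglyProximal := hz.isStronglyProximal.of_subgroup }
  stronglyProximal := hz.isStronglyProximal

end StrongProximality

/-! ### The universal boundary relative to a cyclic group -/

section Universal

variable {G : Type v} [Group G]

/-- The functions on `G` that occur as `g ↦ f (g z)` for a continuous function `f` with values in
`[0, 1]` on a space with an attracting base point `z`. They are characterized by the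
concentration of all the translates of `f` around their value at `z`. -/
def OrbitFunction (t : G) : Type v :=
  {φ : G → unitInterval //
    ∀ k : G, UniformlyAveragesToZero t fun g : G => |(φ (k * g) : ℝ) - φ k|}

/-- The function `g ↦ φ (h g)`. -/
def OrbitFunction.translate {t : G} (h : G) (φ : OrbitFunction t) : OrbitFunction t :=
  ⟨fun g => φ.1 (h * g), fun k => by simpa only [mul_assoc] using φ.2 (h * k)⟩

/-- The evaluation of all orbit functions at `g`. The index set is lifted so that the closure of
the set of evaluations lives in a prescribed universe. -/
def OrbitFunction.eval (t g : G) : ULift.{u} (OrbitFunction t) → unitInterval :=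
  fun φ => φ.down.1 g

/-- The closure of the set of evaluations at group elements in the compact space of all families
of values of orbit functions. -/
abbrev UniversalSpace (t : G) : Type (max u v) :=
  closure (Set.range (OrbitFunction.eval.{u} t))

namespace UniversalSpace

variable {t : G}

instance : CompactSpace (UniversalSpace.{u} t) :=
  isCompact_iff_compactSpace.mp isClosed_closure.isCompact

/-- Left translation by `g`, on families of values of orbit functions. -/
def shift (g : G) (ω : ULift.{u} (OrbitFunction t) → unitInterval) :
    ULift.{u} (OrbitFunction t) → unitInterval :=
  fun φ => ω ⟨φ.down.translate g⟩

theorem continuous_shift (g : G) : Continuous (shift.{u} (t := t) g) :=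
  continuous_pi fun _ => continuous_apply _

instance : MulAction G (UniversalSpace.{u} t) where
  smul g ω := ⟨shift g ω.1, map_mem_closure (continuous_shift g) ω.2 (by
    rintro _ ⟨h, rfl⟩
    exact ⟨g * h, rfl⟩)⟩
  one_smul ω := by
    apply Subtype.ext
    funext φ
    change ω.1 ⟨φ.down.translate 1⟩ = ω.1 φ
    have : φ.down.translate 1 = φ.down := Subtype.ext (funext fun g => by
      simp [OrbitFunction.translate])
    rw [this]
  mul_smul g h ω := by
    apply Subtype.ext
    funext φ
    change ω.1 ⟨φ.down.translate (g * h)⟩ = ω.1 ⟨(φ.down.translate g).translate h⟩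
    simp [OrbitFunction.translate, mul_assoc]

instance : ContinuousConstSMul G (UniversalSpace.{u} t) :=
  ⟨fun g => Continuous.subtype_mk ((continuous_shift g).comp continuous_subtype_val) _⟩

/-- The evaluation at the group element `g`. -/
def point (t g : G) : UniversalSpace.{u} t :=
  ⟨OrbitFunction.eval t g, subset_closure ⟨g, rfl⟩⟩

theorem smul_point (g h : G) : g • point.{u} t h = point t (g * h) := rfl

theorem denseRange_point : DenseRange (point.{u} t) := by
  refine Subtype.dense_iff.mpr ?_
  rw [← Set.range_comp]
  exact subset_rfl

theorem isAttractingBasepoint_point_one : IsAttractingBasepoint t (point.{u} t 1) where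
  denseRange := by simpa only [smul_point, mul_one] using denseRange_point
  uniformDensity_le := by
    rw [← tendsto_id']
    rw [tendsto_subtype_rng, tendsto_pi_nhds]
    intro φ
    rw [tendsto_subtype_rng, tendsto_iff_norm_sub_tendsto_zero]
    refine UniformlyAveragesToZero.tendsto (fun ε hε => ?_) fun _ => norm_nonneg _
    filter_upwards [φ.down.2 1 ε hε] with N hN
    refine fun ω => denseRange_point.induction_on (p := fun ω : UniversalSpace.{u} t =>
      ∑ n ∈ range N, ‖(((t ^ n • ω).1 φ : unitInterval) : ℝ) - (point.{u} t 1).1 φ‖ ≤ ε * N)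
      ω (isClosed_le ?_ continuous_const) fun g => ?_
    · refine continuous_finsetSum _ fun n _ => ((Continuous.sub ?_ continuous_const).norm)
      exact continuous_subtype_val.comp ((continuous_apply φ).comp
        (continuous_subtype_val.comp (continuous_const_smul _)))
    · have := hN g
      simp only [one_mul] at this
      exact this

/-- A space with an attracting base point `z` embeds into the product of intervals indexed by its
continuous functions `f`, and projecting to the coordinates of the orbit functions `g ↦ f (g z)`
maps the universal space to it. -/
theorem exists_map {X : Type w} [TopologicalSpace X] [CompactSpace X] [T2Space X] [MulAction G X]
    [ContinuousConstSMul G X] {z : X} (hz : IsAttractingBasepoint t z) :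
    ∃ ψ : UniversalSpace.{u} t → X, Continuous ψ ∧ Function.Surjective ψ ∧
      ∀ (g : G) (ω : UniversalSpace.{u} t), ψ (g • ω) = g • ψ ω := by
  let orb : C(X, unitInterval) → OrbitFunction t := fun f => ⟨fun g => f (g • z), fun k => by
    have hc : Continuous fun x : X => |(f (k • x) : ℝ) - f (k • z)| :=
      ((continuous_subtype_val.comp (f.continuous.comp (continuous_const_smul k))).sub
        continuous_const).abs
    intro ε hε
    filter_upwards [hz.uniformlyAveragesToZero hc (by simp) ε hε] with N hN g
    simpa only [smul_eq_mul, mul_smul] using hN (g • z)⟩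
  let e : X → C(X, unitInterval) → unitInterval := fun x f => f x
  have he : IsClosedEmbedding e := by
    refine Continuous.isClosedEmbedding (continuous_pi fun f => f.continuous) fun x y hxy => ?_
    by_contra hne
    obtain ⟨f, hf₀, hf₁, hf⟩ := exists_continuous_zero_one_of_isClosed
      (isClosed_singleton (x := x)) (isClosed_singleton (x := y)) (by simpa using hne)
    have := congrArg Subtype.val (congrFun hxy ⟨fun x => ⟨f x, hf x⟩, by fun_prop⟩)
    change f x = f y at this
    rw [hf₀ rfl, hf₁ rfl] at this
    simp at this
  let R : UniversalSpace.{u} t → C(X, unitInterval) → unitInterval := fun ω f => ω.1 ⟨orb f⟩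
  have hR : Continuous R :=
    continuous_pi fun f => (continuous_apply _).comp continuous_subtype_val
  have hRpoint : ∀ g : G, R (point t g) = e (g • z) := fun g => rfl
  have hrange : ∀ ω, R ω ∈ Set.range e := fun ω =>
    denseRange_point.induction_on (p := fun ω => R ω ∈ Set.range e) ω
      (he.isClosed_range.preimage hR) fun g => ⟨g • z, rfl⟩
  choose ψ hψ using hrange
  have hψc : Continuous ψ := by
    rw [he.isInducing.continuous_iff]
    exact hR.congr fun ω => (hψ ω).symm
  have hψpoint : ∀ g : G, ψ (point t g) = g • z := fun g =>
    he.injective ((hψ _).trans (hRpoint g))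
  refine ⟨ψ, hψc, ?_, fun g => ?_⟩
  · rw [← Set.range_eq_univ, ← (isCompact_range hψc).isClosed.closure_eq, ← dense_iff_closure_eq]
    refine hz.denseRange.mono ?_
    rintro _ ⟨g, rfl⟩
    exact ⟨point t g, hψpoint g⟩
  · refine congrFun (denseRange_point.equalizer (hψc.comp (continuous_const_smul g))
      ((continuous_const_smul g).comp hψc) (funext fun h => ?_))
    simp only [Function.comp, smul_point, hψpoint, mul_smul]

end UniversalSpace

theorem isUniversalRelativeBoundary_universalSpace (t : G) :
    IsUniversalRelativeBoundary G (Subgroup.zpowers t) (UniversalSpace.{u} t) where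
  isRelativeBoundary := UniversalSpace.isAttractingBasepoint_point_one.isRelativeBoundary
  universal X _ _ _ hX := by
    have := hX.boundary.compact
    have := hX.boundary.hausdorff
    obtain ⟨z, -, hz⟩ := hX.exists_attractingBasepoint
    exact UniversalSpace.exists_map hz

end Universal

/-! ### Fixed points of homeomorphisms -/

/-- Frolík's theorem for homeomorphisms: a maximal open set `U` with `U ∩ h⁻¹ U = ∅` is clopen, and
the fixed points of `h` are the points outside `U`, `h⁻¹ U` and `h U`. -/
theorem ExtremallyDisconnected.isOpen_fixedPoints {X : Type*} [TopologicalSpace X] [T2Space X]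
    [ExtremallyDisconnected X] (h : X ≃ₜ X) : IsOpen {x : X | h x = x} := by
  obtain ⟨U, hU⟩ := zorn_subset {U : Set X | IsOpen U ∧ Disjoint U (h ⁻¹' U)} (by
    intro c hc hchain
    refine ⟨⋃₀ c, ⟨isOpen_sUnion fun s hs => (hc hs).1, ?_⟩, fun s hs =>
      Set.subset_sUnion_of_mem hs⟩
    rw [Set.disjoint_left]
    rintro x ⟨s, hs, hxs⟩ ⟨r, hr, hxr⟩
    rcases hchain.total hs hr with hsr | hrs
    · exact Set.disjoint_left.mp (hc hr).2 (hsr hxs) hxr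
    · exact Set.disjoint_left.mp (hc hs).2 hxs (hrs hxr))
  obtain ⟨hUo, hUd⟩ := hU.prop
  have hUc : IsClosed U := by
    refine isClosed_of_closure_subset (hU.le_of_ge (y := closure U)
      ⟨open_closure U hUo, ?_⟩ subset_closure)
    rw [h.preimage_closure]
    exact disjoint_closure_of_disjoint_isOpen hUd hUo (hUo.preimage h.continuous)
  have hV : IsClosed (U ∪ h ⁻¹' U ∪ h.symm ⁻¹' U) :=
    (hUc.union (hUc.preimage h.continuous)).union (hUc.preimage h.symm.continuous)
  suffices {x : X | h x = x} = (U ∪ h ⁻¹' U ∪ h.symm ⁻¹' U)ᶜ from this ▸ hV.isOpen_compl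
  refine Set.Subset.antisymm (fun x (hx : h x = x) hmem => ?_) fun x hx => ?_
  · have hx' : h.symm x = x := by rw [h.symm_apply_eq, hx]
    have : x ∈ U := by simpa [hx, hx'] using hmem
    exact Set.disjoint_left.mp hUd this (by simpa [hx] using this)
  · by_contra hne
    obtain ⟨A, B, hA, hB, hxA, hxB, hAB⟩ := t2_separation (Ne.symm hne)
    -- A small neighbourhood of a moved point could be added to `U`.
    let W := A ∩ h ⁻¹' B ∩ (U ∪ h ⁻¹' U ∪ h.symm ⁻¹' U)ᶜ
    have hW : IsOpen W := (hA.inter (hB.preimage h.continuous)).inter hV.isOpen_compl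
    have hxW : x ∈ W := ⟨⟨hxA, hxB⟩, hx⟩
    have hUW : U ∪ W ∈ {U : Set X | IsOpen U ∧ Disjoint U (h ⁻¹' U)} := by
      refine ⟨hUo.union hW, Set.disjoint_left.mpr ?_⟩
      rintro y (hy | hy) (hy' | hy')
      · exact Set.disjoint_left.mp hUd hy hy'
      · exact hy'.2 (Or.inr (by simpa using hy))
      · exact hy.2 (Or.inl (Or.inr hy'))
      · exact Set.disjoint_left.mp hAB hy'.1.1 hy.1.2
    have : x ∈ U := hU.le_of_ge hUW Set.subset_union_left (Or.inr hxW)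
    exact hx (Or.inl (Or.inl this))

/-- If `g` fixed an open set `U` upstairs, finitely many translates of its image, which consists of
fixed points of `g`, would cover `Y`. -/
theorem IsTopologicallyFree.of_finite_fixedPoints {G X Y : Type*} [Group G] [TopologicalSpace X]
    [CompactSpace X] [MulAction G X] [ContinuousConstSMul G X] [MulAction.IsMinimal G X]
    [MulAction G Y] [Infinite Y] {φ : X → Y} (hφ : Function.Surjective φ)
    (hequiv : ∀ (g : G) (x : X), φ (g • x) = g • φ x)
    (hfin : ∀ g : G, g ≠ 1 → {y : Y | g • y = y}.Finite) : IsTopologicallyFree G X := by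
  intro g hg
  by_contra hne
  obtain ⟨I, hI⟩ := isCompact_univ.exists_finite_cover_smul G
    (isOpen_interior (s := {x : X | g • x = x})) (Set.nonempty_iff_ne_empty.mpr hne)
  refine Set.infinite_univ (α := Y) ((I.finite_toSet.biUnion fun a _ =>
    (hfin g hg).image (a • ·)).subset fun y _ => ?_)
  obtain ⟨x, rfl⟩ := hφ y
  obtain ⟨a, ha, x', hx', rfl⟩ := Set.mem_iUnion₂.mp (hI (Set.mem_univ x))
  refine Set.mem_biUnion ha ⟨φ x', ?_, (hequiv a x').symm⟩
  rw [Set.mem_ofPred_eq, ← hequiv]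
  exact congrArg φ (show x' ∈ {x : X | g • x = x} from interior_subset hx')

/-! ### The modular group on the projective line -/

namespace ModularGroup

theorem psl_smul (A : SL(2, ℤ)) (x : OnePoint ℝ) :
    (QuotientGroup.mk A : PSL(2, ℤ)) • x = Matrix.SpecialLinearGroup.mapGL ℝ A • x := rfl

/-- The translation `x ↦ x + 1`, as an element of `PSL(2, ℤ)`. -/
def translation : PSL(2, ℤ) := QuotientGroup.mk T

theorem translation_smul_infty : translation • (OnePoint.infty : OnePoint ℝ) = OnePoint.infty := by
  rw [translation, psl_smul, OnePoint.smul_infty_eq_ite]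
  simp [coe_T]

theorem translation_smul_coe (x : ℝ) :
    translation • (x : OnePoint ℝ) = ((x + 1 : ℝ) : OnePoint ℝ) := by
  rw [translation, psl_smul, OnePoint.smul_some_eq_ite]
  simp [coe_T]

theorem translation_pow_smul_infty (n : ℕ) :
    translation ^ n • (OnePoint.infty : OnePoint ℝ) = OnePoint.infty := by
  induction n with
  | zero => simp
  | succ n ih => rw [pow_succ', mul_smul, ih, translation_smul_infty]

theorem translation_pow_smul_coe (n : ℕ) (x : ℝ) :
    translation ^ n • (x : OnePoint ℝ) = ((x + n : ℝ) : OnePoint ℝ) := by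
  induction n with
  | zero => simp
  | succ n ih => rw [pow_succ', mul_smul, ih, translation_smul_coe, Nat.cast_succ, add_assoc]

theorem continuous_translation_smul : Continuous fun x : OnePoint ℝ => translation • x := by
  refine (OnePoint.continuous_map (f := fun x : ℝ => x + 1) (by fun_prop)
    (by simpa only [coclosedCompact_eq_cocompact] using!
      (Homeomorph.addRight (1 : ℝ)).isClosedEmbedding.tendsto_cocompact)).congr fun x => ?_
  cases x with
  | infty => exact translation_smul_infty.symm
  | coe x => exact (translation_smul_coe x).symm

theorem S_smul_coe {x : ℝ} (hx : x ≠ 0) :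
    (QuotientGroup.mk S : PSL(2, ℤ)) • (x : OnePoint ℝ) = ((-x⁻¹ : ℝ) : OnePoint ℝ) := by
  rw [psl_smul, OnePoint.smul_some_eq_ite]
  simp [coe_S, hx, neg_div]

theorem continuous_S_smul :
    Continuous fun x : OnePoint ℝ => (QuotientGroup.mk S : PSL(2, ℤ)) • x := by
  have h0 : (QuotientGroup.mk S : PSL(2, ℤ)) • ((0 : ℝ) : OnePoint ℝ) = OnePoint.infty := by
    rw [psl_smul, OnePoint.smul_some_eq_ite]
    simp [coe_S]
  have hinf : (QuotientGroup.mk S : PSL(2, ℤ)) • (OnePoint.infty : OnePoint ℝ) =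
      ((0 : ℝ) : OnePoint ℝ) := by
    rw [psl_smul, OnePoint.smul_infty_eq_ite]
    simp [coe_S]
  rw [continuous_iff_continuousAt]
  intro x
  cases x with
  | infty =>
    rw [OnePoint.continuousAt_infty', hinf, coclosedCompact_eq_cocompact,
      ← Metric.cobounded_eq_cocompact]
    have : Tendsto (fun x : ℝ => -x⁻¹) (Bornology.cobounded ℝ) (𝓝 0) := by
      simpa only [neg_zero] using (tendsto_inv₀_cobounded (α := ℝ)).neg
    refine ((OnePoint.continuous_coe.tendsto 0).comp this).congr' ?_
    filter_upwards [show ({0}ᶜ : Set ℝ) ∈ Bornology.cobounded ℝ from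
      Bornology.isBounded_singleton] with y hy
      using (S_smul_coe hy).symm
  | coe x =>
    rw [OnePoint.continuousAt_coe]
    rcases eq_or_ne x 0 with rfl | hx
    · rw [continuousAt_iff_punctured_nhds]
      have : Tendsto (fun x : ℝ => -x⁻¹) (𝓝[≠] 0) (coclosedCompact ℝ) := by
        rw [coclosedCompact_eq_cocompact, ← Metric.cobounded_eq_cocompact]
        exact tendsto_neg_cobounded.comp tendsto_inv₀_nhdsNE_zero
      simp only [Function.comp, h0]
      refine (OnePoint.tendsto_coe_infty.comp this).congr' ?_
      filter_upwards [self_mem_nhdsWithin] with y hy using (S_smul_coe hy).symm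
    · have : ContinuousAt (fun x : ℝ => ((-x⁻¹ : ℝ) : OnePoint ℝ)) x :=
        OnePoint.continuous_coe.continuousAt.comp (continuousAt_inv₀ hx).neg
      refine this.congr ?_
      filter_upwards [isOpen_ne.mem_nhds hx] with y hy using (S_smul_coe hy).symm

instance : ContinuousConstSMul PSL(2, ℤ) (OnePoint ℝ) where
  continuous_const_smul g := by
    obtain ⟨A, rfl⟩ := QuotientGroup.mk_surjective g
    have hA : A ∈ Subgroup.closure {S, T} := by
      simp [SpecialLinearGroup.SL2Z_generators]
    induction hA using Subgroup.closure_induction with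
    | mem A hA =>
      rcases hA with rfl | rfl
      · exact continuous_S_smul
      · exact continuous_translation_smul
    | one => simpa only [QuotientGroup.mk_one, one_smul] using continuous_id'
    | mul A B _ _ hA hB =>
      simp only [QuotientGroup.mk_mul, mul_smul]
      exact hA.comp hB
    | inv A _ hA =>
      rw [QuotientGroup.mk_inv]
      exact Continuous.continuous_symm_of_equiv_compact_to_t2
        (f := MulAction.toPerm (QuotientGroup.mk A : PSL(2, ℤ))) hA

/-- An interval of radius `R` contains at most `2 R + 1` of the translates of a point. -/
theorem uniformDensity_translation_le :
    uniformDensity translation (OnePoint ℝ) ≤ 𝓝 OnePoint.infty := by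
  intro V hV
  obtain ⟨s, ⟨-, hs⟩, hsV⟩ := OnePoint.hasBasis_nhds_infty.mem_iff.mp hV
  refine mem_of_superset ?_ hsV
  obtain ⟨R, hR0, hR⟩ := hs.isBounded.exists_pos_norm_le
  rw [mem_uniformDensity]
  intro ε hε
  filter_upwards [tendsto_natCast_atTop_atTop.eventually_ge_atTop ((2 * R + 1) / ε)] with N hN x
  rw [div_le_iff₀' hε] at hN
  refine le_trans ?_ hN
  cases x with
  | infty =>
    simp only [translation_pow_smul_infty]
    simp
    positivity
  | coe x =>
    simp only [translation_pow_smul_coe]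
    let S := (range N).filter fun n : ℕ => |x + n| ≤ R
    have h₁ : ∑ n ∈ range N, (((↑) '' sᶜ ∪ {OnePoint.infty} : Set (OnePoint ℝ))ᶜ.indicator
        (fun _ => (1 : ℝ)) ((x + n : ℝ) : OnePoint ℝ)) ≤ S.card := by
      rw [Finset.natCast_card_filter]
      refine Finset.sum_le_sum fun n _ => ?_
      by_cases hn : x + n ∈ s
      · have : |x + n| ≤ R := hR _ hn
        simp [hn, this]
      · rw [Set.indicator_of_notMem (not_not.mpr (Or.inl ⟨x + n, hn, rfl⟩))]
        split_ifs <;> norm_num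
    refine h₁.trans ?_
    rcases S.eq_empty_or_nonempty with hS | hS
    · rw [hS]
      simp
      positivity
    · have hmem : ∀ n ∈ S, |x + n| ≤ R := fun n hn => (Finset.mem_filter.mp hn).2
      have hsub : S ⊆ Finset.Icc (S.min' hS) (S.min' hS + ⌊2 * R⌋₊) := by
        intro n hn
        have hmin := S.min'_le n hn
        rw [Finset.mem_Icc]
        refine ⟨hmin, ?_⟩
        have a := abs_le.mp (hmem n hn)
        have b := abs_le.mp (hmem _ (S.min'_mem hS))
        have : n - S.min' hS ≤ ⌊2 * R⌋₊ := by
          apply Nat.le_floor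
          rw [Nat.cast_sub hmin]
          linarith
        omega
      have hcard := Finset.card_le_card hsub
      rw [Nat.card_Icc] at hcard
      calc (S.card : ℝ) ≤ ((⌊2 * R⌋₊ + 1 : ℕ) : ℝ) := by
            exact_mod_cast hcard.trans (by omega)
        _ ≤ 2 * R + 1 := by
          push_cast
          gcongr
          exact Nat.floor_le (by positivity)

theorem exists_smul_infty_eq (q : ℚ) :
    ∃ g : PSL(2, ℤ), g • (OnePoint.infty : OnePoint ℝ) = ((q : ℝ) : OnePoint ℝ) := by
  obtain ⟨A, hA⟩ := isCusp_SL2Z_iff'.mp (isCusp_SL2Z_iff.mpr ⟨(q : OnePoint ℚ), rfl⟩)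
  exact ⟨QuotientGroup.mk A, hA.symm⟩

theorem isAttractingBasepoint_infty :
    IsAttractingBasepoint translation (OnePoint.infty : OnePoint ℝ) where
  denseRange := by
    refine (OnePoint.denseRange_coe.comp Rat.denseRange_cast
      OnePoint.continuous_coe).mono ?_
    rintro _ ⟨q, rfl⟩
    exact exists_smul_infty_eq q
  uniformDensity_le := uniformDensity_translation_le

theorem translation_ne_one : translation ≠ 1 := by
  intro h
  have := translation_smul_coe 0
  rw [h, one_smul, OnePoint.coe_eq_coe] at this
  norm_num at this

/-- The finite fixed points of a Möbius transformation are the roots of a quadratic polynomial. -/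
theorem finite_fixedPoints {g : PSL(2, ℤ)} (hg : g ≠ 1) : {x : OnePoint ℝ | g • x = x}.Finite := by
  obtain ⟨A, rfl⟩ := QuotientGroup.mk_surjective g
  let p := (Matrix.SpecialLinearGroup.mapGL ℝ A).fixpointPolynomial
  have hp : p ≠ 0 := by
    intro h0
    obtain ⟨r, hr⟩ := Matrix.GeneralLinearGroup.fixpointPolynomial_eq_zero_iff.mp h0
    have hr' : ∀ i j, ((A i j : ℤ) : ℝ) = if i = j then r else 0 := fun i j => by
      have := congrFun (congrFun hr i) j
      simp [Matrix.diagonal_apply] at this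
      exact this.symm
    refine hg ((QuotientGroup.eq_one_iff A).mpr
      (Matrix.SpecialLinearGroup.mem_center_iff.mpr ⟨A 0 0, ?_, ?_⟩))
    · have h00 := hr' 0 0
      have h01 := hr' 0 1
      have h11 := hr' 1 1
      simp at h00 h01 h11
      have hdet := A.det_coe
      rw [Matrix.det_fin_two, h01, zero_mul, sub_zero] at hdet
      have : A 0 0 = A 1 1 := by exact_mod_cast h00.trans h11.symm
      simpa [sq, ← this] using hdet
    · ext i j
      have h00 := hr' 0 0
      have hij := hr' i j
      simp only [if_true] at h00
      rw [← h00] at hij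
      rw [Matrix.scalar_apply, Matrix.diagonal_apply]
      exact_mod_cast hij.symm
  refine (((p.rootSet_finite ℝ).image ((↑) : ℝ → OnePoint ℝ)).insert OnePoint.infty).subset
    fun x hx => ?_
  cases x with
  | infty => exact Set.mem_insert _ _
  | coe x =>
    refine Set.mem_insert_of_mem _ ⟨x, (Polynomial.mem_rootSet_of_ne hp).mpr ?_, rfl⟩
    exact Matrix.GeneralLinearGroup.fixpointPolynomial_aeval_eq_zero_iff.mpr hx

/-- An integral matrix of determinant one with vanishing lower left entry is `± Tⁿ`. -/
theorem stabilizerInfty_eq_zpowers : stabilizerInfty = Subgroup.zpowers translation := by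
  refine le_antisymm (fun g hg => ?_) (Subgroup.zpowers_le.mpr translation_smul_infty)
  obtain ⟨A, rfl⟩ := QuotientGroup.mk_surjective g
  have h10 : A 1 0 = 0 := by
    have := OnePoint.smul_infty_eq_self_iff.mp
      (show Matrix.SpecialLinearGroup.mapGL ℝ A • OnePoint.infty = OnePoint.infty from hg)
    simpa using this
  have hdet := A.det_coe
  rw [Matrix.det_fin_two, h10, mul_zero, sub_zero] at hdet
  refine ⟨A 0 0 * A 0 1, ?_⟩
  change (translation ^ (A 0 0 * A 0 1) : PSL(2, ℤ)) = _
  rw [translation, ← QuotientGroup.mk_zpow, QuotientGroup.eq]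
  refine Matrix.SpecialLinearGroup.mem_center_iff.mpr ⟨A 0 0, ?_, ?_⟩
  · rcases Int.eq_one_or_neg_one_of_mul_eq_one hdet with h | h <;> simp [h]
  · rw [← zpow_neg, Matrix.SpecialLinearGroup.coe_mul, coe_T_zpow]
    rcases Int.eq_one_or_neg_one_of_mul_eq_one' hdet with ⟨h, h'⟩ | ⟨h, h'⟩ <;>
    · ext i j
      fin_cases i <;> fin_cases j <;>
      simp [Matrix.mul_apply, Fin.sum_univ_two, h, h', h10]

end ModularGroup

theorem proposition4p1 :
    -- the universal boundary exists
    (∃ (B : Type u) (_ : TopologicalSpace B) (_ : MulAction PSL(2, ℤ) B)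
      (_ : ContinuousConstSMul PSL(2, ℤ) B),
      IsUniversalRelativeBoundary PSL(2, ℤ) stabilizerInfty B) ∧
    -- and every model of it has the stated properties
    (∀ (B : Type u) [TopologicalSpace B] [MulAction PSL(2, ℤ) B]
      [ContinuousConstSMul PSL(2, ℤ) B],
      IsUniversalRelativeBoundary PSL(2, ℤ) stabilizerInfty B →
        IsTopologicallyFree PSL(2, ℤ) B ∧ ¬ IsFreeAction PSL(2, ℤ) B ∧
          ¬ ExtremallyDisconnected B) := by
  rw [ModularGroup.stabilizerInfty_eq_zpowers]
  have huniv := isUniversalRelativeBoundary_universalSpace.{u} ModularGroup.translation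
  refine ⟨⟨_, _, _, _, huniv⟩, fun B _ _ _ hB => ?_⟩
  have := hB.isRelativeBoundary.boundary.compact
  have := hB.isRelativeBoundary.boundary.hausdorff
  have := hB.isRelativeBoundary.boundary.minimal
  -- The projective line lives in `Type`, so `B` is mapped to it through the explicit model.
  obtain ⟨φ, -, hφ, hφG⟩ := hB.universal _ huniv.isRelativeBoundary
  obtain ⟨ψ, -, hψ, hψG⟩ :=
    UniversalSpace.exists_map.{u} ModularGroup.isAttractingBasepoint_infty
  have hfree : IsTopologicallyFree PSL(2, ℤ) B :=
    .of_finite_fixedPoints (hψ.comp hφ) (fun g b => by simp [hφG, hψG])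
      fun g hg => ModularGroup.finite_fixedPoints hg
  obtain ⟨z, hz, -⟩ := hB.isRelativeBoundary.exists_attractingBasepoint
  refine ⟨hfree, fun h => h _ ModularGroup.translation_ne_one z hz, fun _ => ?_⟩
  have hopen := ExtremallyDisconnected.isOpen_fixedPoints
    (Homeomorph.smul ModularGroup.translation : B ≃ₜ B)
  have hempty := hfree _ ModularGroup.translation_ne_one
  have hmem : z ∈ interior {x : B | ModularGroup.translation • x = x} := hopen.interior_eq.ge hz
  rw [hempty] at hmem
  exact hmem
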